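/- Fix $m$ and a probability space. A random model $\{W(k)\}_{k\ge 0}$ is a sequence of random $m\times m$ (row-)stochastic matrices with measurable entries; it is independent if the matrices $W(0),W(1),\dots$ are mutually independent. A deterministic chain $\{A(k)\}$ of stochastic matrices drives the dynamics $x(k+1)=A(k)x(k)$, $k\ge t_0$. An index $i$ is an ergodic index for $\{A(k)\}$ if $\lim_{k\to\infty}x_i(k)$ exists for every $t_0\ge 0$ and every $x(t_0)\in\mathbb{R}^m$; the chain is stable if every index is ergodic; indices $i,j$ are mutually ergodic, $i\Leftrightarrow_A j$, if both are ergodic indices and $\lim_{k\to\infty}(x_i(k)-x_j(k))=0$ for every $t_0\ge0$ and every $x(t_0)\in\mathbb{R}^m$. A random model has one of these properties if almost every realization does. The infinite flow graph of a random model $\{W(k)\}$ is the simple graph on $\{1,\dots,m\}$ in which $i\ne j$ are adjacent if and only if $\sum_{k\ge 0}(W_{ij}(k)+W_{ji}(k))=\infty$ almost surely (for a deterministic chain: if and only if this sum is infinite). A random model $\{U(k)\}$ has a common steady state $\pi>0$ in expectation if $\pi\in\mathbb{R}^m$ has positive entries and $\pi^T\mathbb{E}[U(k)]=\pi^T$ for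 all $k\ge0$; it has the weak feedback property if there is $\gamma>0$ such that $\mathbb{E}\big[\sum_{\ell}U_{\ell i}(k)U_{\ell j}(k)\big]\ge\gamma\,(\mathbb{E}[U_{ij}(k)]+\mathbb{E}[U_{ji}(k)])$ for all $k\ge0$ and all $i\neq j$. Random models $\{W(k)\}$ and $\{U(k)\}$ on the same probability space are $\ell_1$-approximations of each other if $\sum_{k\ge0}|W_{ij}(k)-U_{ij}(k)|<\infty$ almost surely for all $i,j$. Theorem (Extended Infinite Flow Theorem). Let $\{W(k)\}$ be an independent random model that is an $\ell_1$-approximation of an independent random model $\{U(k)\}$ with a common steady state $\pi>0$ in expectation and the weak feedback property. Let $G^\infty$ be the infinite flow graph of $\{W(k)\}$ and $\bar G^\infty$ the infinite flow graph of the expected chain $\bar W(k)=\mathbb{E}[W(k)]$. Then $\{W(k)\}$ is stable almost surely, and for all $i,j\in\{1,\dots,m\}$ the following statements are equivalent: (a) $i\Leftrightarrow_W j$ (almost surely); (b) $i\Leftrightarrow_{\bar W} j$; (c) $i$ and $j$ belong to the same connected component of $\bar G^\infty$; (d) $i$ and $j$ belong to the same connected component of $G^\infty$. -/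

import Mathlib

open MeasureTheory ProbabilityTheory Filter Topology
open scoped ENNReal Matrix

noncomputable section

namespace RandomChain

variable {m : ℕ} {Ω : Type*} [MeasurableSpace Ω]

/-! ### Deterministic chains -/

/-- The sequence `x` follows the dynamics `x(k+1) = A(k) x(k)` from the initial time `t₀` on
(the values `x k` with `k < t₀` are irrelevant). -/
def IsTrajectory (A : ℕ → Matrix (Fin m) (Fin m) ℝ) (t₀ : ℕ) (x : ℕ → Fin m → ℝ) : Prop :=
  ∀ k, t₀ ≤ k → x (k + 1) = A k *ᵥ x k

/-- `i` and `j` are mutually weakly ergodic indices for the chain `A`. -/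
def MutuallyWeaklyErgodic (A : ℕ → Matrix (Fin m) (Fin m) ℝ) (i j : Fin m) : Prop :=
  ∀ (t₀ : ℕ) (x : ℕ → Fin m → ℝ), IsTrajectory A t₀ x →
    Tendsto (fun k => x k i - x k j) atTop (𝓝 0)

/-- `i` is an ergodic index for the chain `A`. -/
def ErgodicIndex (A : ℕ → Matrix (Fin m) (Fin m) ℝ) (i : Fin m) : Prop :=
  ∀ (t₀ : ℕ) (x : ℕ → Fin m → ℝ), IsTrajectory A t₀ x →
    ∃ l : ℝ, Tendsto (fun k => x k i) atTop (𝓝 l)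

/-- The chain `A` is stable: every index is an ergodic index. -/
def Stable (A : ℕ → Matrix (Fin m) (Fin m) ℝ) : Prop :=
  ∀ i, ErgodicIndex A i

/-- `i` and `j` are mutually ergodic indices for the chain `A`. -/
def MutuallyErgodic (A : ℕ → Matrix (Fin m) (Fin m) ℝ) (i j : Fin m) : Prop :=
  ErgodicIndex A i ∧ ErgodicIndex A j ∧ MutuallyWeaklyErgodic A i j

/-- `∑ₖ (A_ij(k) + A_ji(k)) = ∞`, for a chain with nonnegative entries. -/
def InfiniteFlow (A : ℕ → Matrix (Fin m) (Fin m) ℝ) (i j : Fin m) : Prop :=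
  ∑' k, ENNReal.ofReal (A k i j + A k j i) = ∞

/-- The infinite flow graph of a deterministic chain. -/
def flowGraph (A : ℕ → Matrix (Fin m) (Fin m) ℝ) : SimpleGraph (Fin m) where
  Adj i j := i ≠ j ∧ InfiniteFlow A i j
  symm := ⟨fun i j h => ⟨h.1.symm, by simpa only [InfiniteFlow, add_comm] using h.2⟩⟩
  loopless := ⟨fun _ h => h.1 rfl⟩

/-! ### Random chains -/

/-- A random model: a sequence of random (row-)stochastic matrices with measurable entries. -/
structure IsRandomModel (W : ℕ → Ω → Matrix (Fin m) (Fin m) ℝ) : Prop where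
  measurable : ∀ k i j, Measurable fun ω => W k ω i j
  stochastic : ∀ k ω, W k ω ∈ Matrix.rowStochastic ℝ (Fin m)

/-- An independent random model: the random matrices `W(0), W(1), …`, viewed as random families
of entries, are mutually independent. -/
structure IsIndependentModel (μ : Measure Ω) (W : ℕ → Ω → Matrix (Fin m) (Fin m) ℝ) : Prop
    extends IsRandomModel W where
  indep : iIndepFun (fun k ω (p : Fin m × Fin m) => W k ω p.1 p.2) μ

/-- The expected chain `E[W(k)]`. -/
def expectedChain (μ : Measure Ω) (W : ℕ → Ω → Matrix (Fin m) (Fin m) ℝ) :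
    ℕ → Matrix (Fin m) (Fin m) ℝ :=
  fun k => Matrix.of fun i j => ∫ ω, W k ω i j ∂μ

/-- `π` is a common steady state in expectation: `πᵀ E[W(k)] = πᵀ` for all `k`. -/
def IsCommonSteadyState (μ : Measure Ω) (W : ℕ → Ω → Matrix (Fin m) (Fin m) ℝ)
    (π : Fin m → ℝ) : Prop :=
  ∀ k, π ᵥ* expectedChain μ W k = π

/-- Weak feedback property; `∑ l, W_li W_lj` is the inner product of the columns `i` and `j`. -/
def WeakFeedback (μ : Measure Ω) (W : ℕ → Ω → Matrix (Fin m) (Fin m) ℝ) : Prop :=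
  ∃ γ : ℝ, 0 < γ ∧ ∀ k i j, i ≠ j →
    γ * ((∫ ω, W k ω i j ∂μ) + ∫ ω, W k ω j i ∂μ) ≤ ∫ ω, ∑ l, W k ω l i * W k ω l j ∂μ

/-- `U` is an `ℓ₁`-approximation of `W`, almost surely. -/
def IsL1Approximation (μ : Measure Ω) (U W : ℕ → Ω → Matrix (Fin m) (Fin m) ℝ) : Prop :=
  ∀ i j, ∀ᵐ ω ∂μ, Summable fun k => |W k ω i j - U k ω i j|

/-- The infinite flow graph of a random model: `{i, j}` is an edge if and only if
`∑ₖ (W_ij(k) + W_ji(k)) = ∞` almost surely. -/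
def randomFlowGraph (μ : Measure Ω) (W : ℕ → Ω → Matrix (Fin m) (Fin m) ℝ) :
    SimpleGraph (Fin m) where
  Adj i j := i ≠ j ∧ ∀ᵐ ω ∂μ, InfiniteFlow (fun k => W k ω) i j
  symm := ⟨fun i j h => ⟨h.1.symm, by simpa only [InfiniteFlow, add_comm] using h.2⟩⟩
  loopless := ⟨fun _ h => h.1 rfl⟩

end RandomChain

end

noncomputable section

namespace RandomChain

/-! ### A convergence criterion for slowly varying vectors -/

/-! Stability and all the ergodicity of `W` come from `U`: a tail of a trajectory of one chain is
followed, up to any ε, by a trajectory of an `ℓ₁`-close chain, because stochastic matrices do not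
expand the sup norm. Infinite flow transfers in the same way.

For `U`, let x be a column of the transition matrices. Since U(k) is independent of the past and π
is stationary in expectation, E Σ π_i x_i² is nonincreasing. By weak feedback each step loses at
least κ E[(x_a - x_b)² (U_ab + U_ba)], so almost surely these flow-weighted squares are summable
(`ae_summable_flow_mul_sq`). Hence the increments of x tend to zero, and infinite flow between two
indices forces equal limits once the limits exist.

Vanishing increments do not exclude a slow drift. For that, Σ π_j |x_j - c| is a bounded
supermartingale for every c, so almost surely it has a limit L(c) for all rational c. L is convex
with slopes bounded by Σ π_j. If x_i oscillated across an interval, it would come close to each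
point of a fine grid there infinitely often, and each grid point would add at least π_i to the slope
of L; a long enough grid contradicts the bound (`exists_tendsto_of_tendsto_weighted_abs`).

The equivalence is a cycle. (a) gives (b) by taking expectations, which commute with products of
independent matrices. (b) gives (c) because finite flow across a cut keeps some trajectory
separated. (c) gives (d) because independent bounded variables with divergent expectations have a
divergent sum. (d) gives (a) by adding the conclusions for `U`, transferred to `W`, along a walk. -/

/-- A real sequence with vanishing increments that is infinitely often below and infinitely often
above `c` comes infinitely often close to `c`. -/
theorem frequently_abs_sub_le_of_crossing {u : ℕ → ℝ} {c δ : ℝ} (hδ : 0 < δ)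
    (hinc : Tendsto (fun k => u (k + 1) - u k) atTop (𝓝 0))
    (hlo : ∃ᶠ k in atTop, u k < c) (hhi : ∃ᶠ k in atTop, c < u k) :
    ∃ᶠ k in atTop, |u k - c| ≤ δ := by
  by_contra hcon
  rw [not_frequently] at hcon
  have hsmall : ∀ᶠ k in atTop, |u (k + 1) - u k| < δ := by
    have := hinc.eventually (Metric.ball_mem_nhds (0 : ℝ) hδ)
    simpa [Real.dist_eq] using this
  obtain ⟨K, hK⟩ := eventually_atTop.1 (hcon.and hsmall)
  obtain ⟨k₀, hk₀, hlt⟩ := frequently_atTop.1 hlo K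
  -- A jump shorter than δ cannot cross the empty band of radius δ around c.
  have hstay : ∀ k, k₀ ≤ k → u k < c := by
    intro k hk
    induction k, hk using Nat.le_induction with
    | base => exact hlt
    | succ k hk ih =>
      obtain ⟨h₁, h₂⟩ := hK k (hk₀.trans hk)
      have h₃ : δ < |u k - c| := not_le.1 h₁
      rw [abs_of_neg (by linarith)] at h₃
      linarith [(abs_lt.1 h₂).2]
  obtain ⟨k, hk, hgt⟩ := frequently_atTop.1 hhi k₀
  exact absurd (hstay k hk) (not_lt.2 hgt.le)

/-- Convexity of c ↦ |t - c|. The next lemma measures its kink: a grid point within half a mesh of t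
carries a second difference of at least d. -/
theorem abs_second_difference_nonneg (t c d : ℝ) :
    0 ≤ |t - (c - d)| + |t - (c + d)| - 2 * |t - c| := by
  have h := abs_add_le (t - (c - d)) (t - (c + d))
  rw [show t - (c - d) + (t - (c + d)) = 2 * (t - c) by ring, abs_mul, abs_two] at h
  linarith

theorem abs_second_difference_ge {t c d : ℝ} (h : |t - c| ≤ d / 2) :
    d ≤ |t - (c - d)| + |t - (c + d)| - 2 * |t - c| := by
  have h₁ := le_abs_self (t - (c - d))
  have h₂ := neg_abs_le (t - (c + d))
  linarith

/-- A bounded sequence of vectors with vanishing increments whose weighted absolute deviations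
from every rational number converge is itself convergent. -/
theorem exists_tendsto_of_tendsto_weighted_abs {m : ℕ} {π : Fin m → ℝ} (hπ : ∀ i, 0 < π i)
    {x : ℕ → Fin m → ℝ} {C : ℝ} (hbdd : ∀ k i, |x k i| ≤ C)
    (hinc : ∀ i, Tendsto (fun k => x (k + 1) i - x k i) atTop (𝓝 0))
    (hconv : ∀ q : ℚ, ∃ L, Tendsto (fun k => ∑ j, π j * |x k j - q|) atTop (𝓝 L)) (i : Fin m) :
    ∃ l, Tendsto (fun k => x k i) atTop (𝓝 l) := by
  choose L hL using hconv
  have hLip : ∀ p q : ℚ, L p - L q ≤ |(p : ℝ) - q| * ∑ j, π j := by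
    intro p q
    refine le_of_tendsto ((hL p).sub (hL q)) (Eventually.of_forall fun k => ?_)
    rw [← Finset.sum_sub_distrib, Finset.mul_sum]
    refine Finset.sum_le_sum fun j _ => ?_
    rw [← mul_sub, mul_comm]
    refine mul_le_mul_of_nonneg_right ?_ (hπ j).le
    have := abs_sub_abs_le_abs_sub (x k j - p) (x k j - q)
    rw [show x k j - p - (x k j - q) = -((p : ℝ) - q) by ring, abs_neg] at this
    exact this
  refine tendsto_of_no_upcrossings (s := Set.range ((↑) : ℚ → ℝ)) Rat.denseRange_cast ?_
    ⟨C, eventually_map.2 <| Eventually.of_forall fun k => (abs_le.1 (hbdd k i)).2⟩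
    ⟨-C, eventually_map.2 <| Eventually.of_forall fun k => (abs_le.1 (hbdd k i)).1⟩
  rintro _ ⟨a, rfl⟩ _ ⟨b, rfl⟩ hab ⟨hlo, hhi⟩
  have hab' : a < b := by exact_mod_cast hab
  -- The grid from a to b has N interior points, hence mesh (b - a) / (N + 1). Each contributes π_i
  -- d to the telescoped second differences of L, whose total is at most 2 d Σ π_j; this N makes
  -- that impossible.
  obtain ⟨N, hN⟩ := exists_nat_gt (2 * (∑ j, π j) / π i)
  rw [div_lt_iff₀ (hπ i)] at hN
  set d : ℚ := (b - a) / (N + 1) with hd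
  have hN1 : (0 : ℚ) < N + 1 := by positivity
  have hd0 : 0 < d := div_pos (sub_pos.2 hab') hN1
  have hd0' : (0 : ℝ) < d := by exact_mod_cast hd0
  have hdN : (N + 1) * d = b - a := by rw [hd]; field_simp
  let c : ℕ → ℚ := fun q => a + q * d
  have hstep : ∀ q, c (q + 1) - c q = d := fun q => by simp only [c]; push_cast; ring
  have hlow : ∀ q ∈ Finset.range N, π i * d ≤
      (L (c (q + 2)) - L (c (q + 1))) - (L (c (q + 1)) - L (c q)) := by
    intro q hq
    have hqN : (q : ℚ) + 1 ≤ N := by exact_mod_cast Finset.mem_range.1 hq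
    have hca : a < c (q + 1) := by
      simp only [c]; push_cast; nlinarith [(Nat.cast_nonneg q : (0 : ℚ) ≤ q)]
    have hcb : c (q + 1) < b := by simp only [c]; push_cast; nlinarith
    have hca' : (a : ℝ) < c (q + 1) := by exact_mod_cast hca
    have hcb' : (c (q + 1) : ℝ) < b := by exact_mod_cast hcb
    have hfreq := frequently_abs_sub_le_of_crossing (half_pos hd0') (hinc i)
      (hlo.mono fun k hk => hk.trans hca') (hhi.mono fun k hk => hcb'.trans hk)
    have hlim := ((hL (c (q + 2))).sub (hL (c (q + 1)))).sub ((hL (c (q + 1))).sub (hL (c q)))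
    -- The limit is already known to exist, so a bound at infinitely many times suffices.
    refine ge_of_tendsto_of_frequently hlim (hfreq.mono fun k hk => ?_)
    have e₁ : (c q : ℝ) = c (q + 1) - d := by
      have := hstep q; rw [← this]; push_cast; ring
    have e₂ : (c (q + 2) : ℝ) = c (q + 1) + d := by
      have := hstep (q + 1); rw [← this]; push_cast; ring
    rw [← Finset.sum_sub_distrib, ← Finset.sum_sub_distrib, ← Finset.sum_sub_distrib, e₁, e₂]
    have hterm : ∀ j, π j * |x k j - (c (q + 1) + d)| - π j * |x k j - c (q + 1)| -
        (π j * |x k j - c (q + 1)| - π j * |x k j - (c (q + 1) - d)|) =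
        π j * (|x k j - (c (q + 1) - d)| + |x k j - (c (q + 1) + d)| -
          2 * |x k j - c (q + 1)|) := fun j => by ring
    simp only [hterm]
    refine le_trans ?_ (Finset.single_le_sum (f := fun j => π j *
      (|x k j - (c (q + 1) - d)| + |x k j - (c (q + 1) + d)| - 2 * |x k j - c (q + 1)|))
      (fun j _ => mul_nonneg (hπ j).le (abs_second_difference_nonneg _ _ _))
      (Finset.mem_univ i))
    exact mul_le_mul_of_nonneg_left (abs_second_difference_ge hk) (hπ i).le
  have hsum := Finset.sum_le_sum hlow
  rw [Finset.sum_range_sub (fun q => L (c (q + 1)) - L (c q))] at hsum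
  simp only [Finset.sum_const, Finset.card_range, nsmul_eq_mul] at hsum
  have h₁ := hLip (c (N + 1)) (c N)
  have h₂ := hLip (c 0) (c (0 + 1))
  have e₁ : |(c (N + 1) : ℝ) - c N| = d := by
    rw [← Rat.cast_sub, hstep, abs_of_pos hd0']
  have e₂ : |(c 0 : ℝ) - c (0 + 1)| = d := by
    rw [abs_sub_comm, ← Rat.cast_sub, hstep, abs_of_pos hd0']
  rw [e₁] at h₁
  rw [e₂] at h₂
  nlinarith

section Deterministic

/-! ### Transition matrices of deterministic chains -/

variable {m : ℕ}

/-- The product `A(k-1) ⋯ A(0)`. -/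
def transition (A : ℕ → Matrix (Fin m) (Fin m) ℝ) : ℕ → Matrix (Fin m) (Fin m) ℝ
  | 0 => 1
  | k + 1 => A k * transition A k

theorem transition_mem {A : ℕ → Matrix (Fin m) (Fin m) ℝ}
    (hA : ∀ k, A k ∈ Matrix.rowStochastic ℝ (Fin m)) (k : ℕ) :
    transition A k ∈ Matrix.rowStochastic ℝ (Fin m) := by
  induction k with
  | zero => exact one_mem _
  | succ k ih => exact mul_mem (hA k) ih

theorem transition_succ_apply (A : ℕ → Matrix (Fin m) (Fin m) ℝ) (k : ℕ) (i l : Fin m) :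
    transition A (k + 1) i l = ∑ j, A k i j * transition A k j l := rfl

theorem abs_transition_le_one {A : ℕ → Matrix (Fin m) (Fin m) ℝ}
    (hA : ∀ k, A k ∈ Matrix.rowStochastic ℝ (Fin m)) (k : ℕ) (i l : Fin m) :
    |transition A k i l| ≤ 1 := by
  rw [abs_of_nonneg (Matrix.nonneg_of_mem_rowStochastic (transition_mem hA k))]
  exact Matrix.le_one_of_mem_rowStochastic (transition_mem hA k)

theorem IsTrajectory.eq_transition {A : ℕ → Matrix (Fin m) (Fin m) ℝ} {t₀ : ℕ}
    {x : ℕ → Fin m → ℝ} (hx : IsTrajectory A t₀ x) (k : ℕ) :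
    x (t₀ + k) = transition (fun k => A (t₀ + k)) k *ᵥ x t₀ := by
  induction k with
  | zero => simp [transition]
  | succ k ih =>
    rw [← add_assoc, hx _ (Nat.le_add_right _ _), ih, transition, Matrix.mulVec_mulVec]

theorem isTrajectory_transition (A : ℕ → Matrix (Fin m) (Fin m) ℝ) (t₀ : ℕ) (v : Fin m → ℝ) :
    IsTrajectory A t₀ fun k => transition (fun k => A (t₀ + k)) (k - t₀) *ᵥ v := by
  intro k hk
  obtain ⟨k, rfl⟩ := Nat.exists_eq_add_of_le hk
  simp only [show t₀ + k + 1 - t₀ = k + 1 by omega, show t₀ + k - t₀ = k by omega, transition,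
    Matrix.mulVec_mulVec]

/-- Trajectories are linear in their initial vector, so unit vectors suffice. Only countably many
conditions (t₀, l) remain, which lets almost sure statements be proved one at a time. -/
theorem ergodicIndex_iff_transition {A : ℕ → Matrix (Fin m) (Fin m) ℝ} {i : Fin m} :
    ErgodicIndex A i ↔ ∀ t₀ l, ∃ L : ℝ,
      Tendsto (fun k => transition (fun k => A (t₀ + k)) k i l) atTop (𝓝 L) := by
  constructor
  · intro h t₀ l
    obtain ⟨L, hL⟩ := h t₀ _ (isTrajectory_transition A t₀ (Pi.single l 1))
    refine ⟨L, ?_⟩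
    simpa [Function.comp_def] using hL.comp (tendsto_add_atTop_nat t₀)
  · intro h t₀ x hx
    choose L hL using h t₀
    refine ⟨∑ l, L l * x t₀ l, ?_⟩
    rw [← tendsto_add_atTop_iff_nat t₀]
    simp only [add_comm _ t₀, hx.eq_transition]
    exact tendsto_finsetSum _ fun l _ => (hL l).mul_const _

theorem mutuallyWeaklyErgodic_iff_transition {A : ℕ → Matrix (Fin m) (Fin m) ℝ} {i j : Fin m} :
    MutuallyWeaklyErgodic A i j ↔ ∀ t₀ l,
      Tendsto (fun k => transition (fun k => A (t₀ + k)) k i l -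
        transition (fun k => A (t₀ + k)) k j l) atTop (𝓝 0) := by
  constructor
  · intro h t₀ l
    have hL := h t₀ _ (isTrajectory_transition A t₀ (Pi.single l 1))
    simpa [Function.comp_def] using hL.comp (tendsto_add_atTop_nat t₀)
  · intro h t₀ x hx
    rw [← tendsto_add_atTop_iff_nat t₀]
    simp only [add_comm _ t₀, hx.eq_transition, Matrix.mulVec, dotProduct,
      ← Finset.sum_sub_distrib, ← sub_mul]
    simpa using tendsto_finsetSum Finset.univ fun l _ => (h t₀ l).mul_const (x t₀ l)

/-! ### `ℓ₁`-approximations of deterministic chains -/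

theorem norm_mulVec_le_of_mem_rowStochastic {A : Matrix (Fin m) (Fin m) ℝ}
    (hA : A ∈ Matrix.rowStochastic ℝ (Fin m)) (v : Fin m → ℝ) : ‖A *ᵥ v‖ ≤ ‖v‖ := by
  refine (pi_norm_le_iff_of_nonneg (norm_nonneg _)).2 fun i => ?_
  calc ‖∑ j, A i j * v j‖ ≤ ∑ j, ‖A i j * v j‖ := norm_sum_le _ _
    _ ≤ ∑ j, A i j * ‖v‖ := Finset.sum_le_sum fun j _ => by
        rw [norm_mul, Real.norm_of_nonneg (Matrix.nonneg_of_mem_rowStochastic hA)]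
        exact mul_le_mul_of_nonneg_left (norm_le_pi_norm v j)
          (Matrix.nonneg_of_mem_rowStochastic hA)
    _ = ‖v‖ := by rw [← Finset.sum_mul, Matrix.sum_row_of_mem_rowStochastic hA, one_mul]

theorem norm_mulVec_le_sum_abs (A : Matrix (Fin m) (Fin m) ℝ) (v : Fin m → ℝ) :
    ‖A *ᵥ v‖ ≤ (∑ i, ∑ j, |A i j|) * ‖v‖ := by
  refine (pi_norm_le_iff_of_nonneg (by positivity)).2 fun i => ?_
  calc ‖∑ j, A i j * v j‖ ≤ ∑ j, ‖A i j * v j‖ := norm_sum_le _ _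
    _ ≤ ∑ j, |A i j| * ‖v‖ := Finset.sum_le_sum fun j _ => by
        rw [norm_mul]
        exact mul_le_mul_of_nonneg_left (norm_le_pi_norm v j) (abs_nonneg _)
    _ = (∑ j, |A i j|) * ‖v‖ := by rw [Finset.sum_mul]
    _ ≤ _ := mul_le_mul_of_nonneg_right
        (Finset.single_le_sum (f := fun i => ∑ j, |A i j|)
          (fun i _ => Finset.sum_nonneg fun j _ => abs_nonneg _) (Finset.mem_univ i))
        (norm_nonneg _)

/-- Trajectories of a chain are shadowed by trajectories of its `ℓ₁`-approximations. -/
theorem exists_trajectory_norm_sub_le {A B : ℕ → Matrix (Fin m) (Fin m) ℝ}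
    (hA : ∀ k, A k ∈ Matrix.rowStochastic ℝ (Fin m))
    (hB : ∀ k, B k ∈ Matrix.rowStochastic ℝ (Fin m))
    (hAB : ∀ i j, Summable fun k => |A k i j - B k i j|)
    {t₀ : ℕ} {x : ℕ → Fin m → ℝ} (hx : IsTrajectory A t₀ x) {ε : ℝ} (hε : 0 < ε) :
    ∃ T y, IsTrajectory B T y ∧ ∀ k, T ≤ k → ‖x k - y k‖ ≤ ε := by
  set δ : ℕ → ℝ := fun k => ∑ i, ∑ j, |(A k - B k) i j| with hδ
  have hδ0 : ∀ k, 0 ≤ δ k := fun k =>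
    Finset.sum_nonneg fun i _ => Finset.sum_nonneg fun j _ => abs_nonneg _
  have hsum : Summable δ := summable_sum fun i _ => summable_sum fun j _ => hAB i j
  set M : ℝ := ‖x t₀‖ with hM
  have hxM : ∀ k, t₀ ≤ k → ‖x k‖ ≤ M := by
    intro k hk
    induction k, hk using Nat.le_induction with
    | base => exact le_rfl
    | succ k hk ih =>
      rw [hx k hk]
      exact (norm_mulVec_le_of_mem_rowStochastic (hA k) _).trans ih
  have htail := tendsto_sum_nat_add δ
  have hM0 : 0 ≤ M := norm_nonneg _
  have hlim : Tendsto (fun T => (∑' k, δ (k + T)) * M) atTop (𝓝 0) := by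
    simpa using htail.mul_const M
  -- After T the total perturbation, scaled by the bound M on x, is below ε. The shadow restarts
  -- from x(T), and the errors merely add up.
  obtain ⟨T, hTε, hT⟩ := ((hlim.eventually (gt_mem_nhds hε)).and (eventually_ge_atTop t₀)).exists
  refine ⟨T, fun k => transition (fun k => B (T + k)) (k - T) *ᵥ x T,
    isTrajectory_transition B T (x T), fun k hk => ?_⟩
  have hy := isTrajectory_transition B T (x T)
  set y := fun k => transition (fun k => B (T + k)) (k - T) *ᵥ x T
  have hbound : ∀ n, ‖x (T + n) - y (T + n)‖ ≤ (∑ s ∈ Finset.range n, δ (s + T)) * M := by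
    intro n
    induction n with
    | zero => simp [y, transition]
    | succ n ih =>
      have e : x (T + (n + 1)) - y (T + (n + 1)) =
          B (T + n) *ᵥ (x (T + n) - y (T + n)) + (A (T + n) - B (T + n)) *ᵥ x (T + n) := by
        rw [← add_assoc, hx _ (by omega), hy _ (by omega), Matrix.mulVec_sub, Matrix.sub_mulVec]
        abel
      rw [e, Finset.sum_range_succ, add_mul]
      refine (norm_add_le _ _).trans (add_le_add
        ((norm_mulVec_le_of_mem_rowStochastic (hB _) _).trans ih) ?_)
      rw [add_comm n T]
      exact (norm_mulVec_le_sum_abs _ _).trans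
        (mul_le_mul_of_nonneg_left (hxM _ (by omega)) (hδ0 _))
  obtain ⟨n, rfl⟩ := Nat.exists_eq_add_of_le hk
  refine (hbound n).trans ((mul_le_mul_of_nonneg_right ?_ hM0).trans hTε.le)
  exact Summable.sum_le_tsum _ (fun s _ => hδ0 _) ((summable_nat_add_iff T).2 hsum)

/-- The shadowing trajectory depends on ε, so no limit can be copied from it; the Cauchy criterion
is checked instead, with three errors of ε/4. -/
theorem ErgodicIndex.of_l1 {A B : ℕ → Matrix (Fin m) (Fin m) ℝ}
    (hA : ∀ k, A k ∈ Matrix.rowStochastic ℝ (Fin m))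
    (hB : ∀ k, B k ∈ Matrix.rowStochastic ℝ (Fin m))
    (hAB : ∀ i j, Summable fun k => |A k i j - B k i j|) {i : Fin m} (h : ErgodicIndex B i) :
    ErgodicIndex A i := by
  intro t₀ x hx
  refine cauchySeq_tendsto_of_complete (Metric.cauchySeq_iff'.2 fun ε hε => ?_)
  obtain ⟨T, y, hy, hxy⟩ := exists_trajectory_norm_sub_le hA hB hAB hx
    (show 0 < ε / 4 by positivity)
  obtain ⟨l, hl⟩ := h T y hy
  have hcomp : ∀ k, T ≤ k → |x k i - y k i| ≤ ε / 4 := fun k hk =>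
    (norm_le_pi_norm (x k - y k) i).trans (hxy k hk)
  obtain ⟨K', hK'⟩ := Metric.cauchySeq_iff.1 hl.cauchySeq (ε / 4) (by positivity)
  refine ⟨max K' T, fun n hn => ?_⟩
  have h₁ := hcomp n (le_of_max_le_right hn)
  have h₂ := hcomp (max K' T) (le_max_right _ _)
  have h₃ := hK' n (le_of_max_le_left hn) (max K' T) (le_max_left _ _)
  rw [Real.dist_eq] at h₃ ⊢
  rw [abs_le] at h₁ h₂
  rw [abs_lt] at h₃ ⊢
  constructor <;> linarith [h₁.1, h₁.2, h₂.1, h₂.2, h₃.1, h₃.2]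

theorem MutuallyWeaklyErgodic.of_l1 {A B : ℕ → Matrix (Fin m) (Fin m) ℝ}
    (hA : ∀ k, A k ∈ Matrix.rowStochastic ℝ (Fin m))
    (hB : ∀ k, B k ∈ Matrix.rowStochastic ℝ (Fin m))
    (hAB : ∀ i j, Summable fun k => |A k i j - B k i j|) {i j : Fin m}
    (h : MutuallyWeaklyErgodic B i j) : MutuallyWeaklyErgodic A i j := by
  intro t₀ x hx
  refine Metric.tendsto_atTop.2 fun ε hε => ?_
  obtain ⟨T, y, hy, hxy⟩ := exists_trajectory_norm_sub_le hA hB hAB hx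
    (show 0 < ε / 4 by positivity)
  obtain ⟨K, hK⟩ := Metric.tendsto_atTop.1 (h T y hy) (ε / 4) (by positivity)
  have hcomp : ∀ i k, T ≤ k → |x k i - y k i| ≤ ε / 4 := fun i k hk =>
    (norm_le_pi_norm (x k - y k) i).trans (hxy k hk)
  refine ⟨max K T, fun n hn => ?_⟩
  have h₁ := hcomp i n (le_of_max_le_right hn)
  have h₂ := hcomp j n (le_of_max_le_right hn)
  have h₃ := hK n (le_of_max_le_left hn)
  rw [Real.dist_eq] at h₃ ⊢
  rw [abs_le] at h₁ h₂
  rw [abs_lt] at h₃ ⊢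
  constructor <;> linarith [h₁.1, h₁.2, h₂.1, h₂.2, h₃.1, h₃.2]

/-! ### The infinite flow graph of a deterministic chain -/

theorem tsum_ofReal_eq_top_iff {f : ℕ → ℝ} (hf : ∀ k, 0 ≤ f k) :
    ∑' k, ENNReal.ofReal (f k) = ∞ ↔ ¬ Summable f := by
  constructor
  · exact fun h hs => hs.tsum_ofReal_ne_top h
  · intro h
    by_contra hne
    refine h ?_
    have := ENNReal.summable_toReal hne
    simpa only [ENNReal.toReal_ofReal (hf _)] using this

theorem infiniteFlow_iff {A : ℕ → Matrix (Fin m) (Fin m) ℝ}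
    (hA : ∀ k, A k ∈ Matrix.rowStochastic ℝ (Fin m)) {i j : Fin m} :
    InfiniteFlow A i j ↔ ¬ Summable fun k => A k i j + A k j i :=
  tsum_ofReal_eq_top_iff fun k => add_nonneg (Matrix.nonneg_of_mem_rowStochastic (hA k))
    (Matrix.nonneg_of_mem_rowStochastic (hA k))

theorem InfiniteFlow.of_l1 {A B : ℕ → Matrix (Fin m) (Fin m) ℝ}
    (hA : ∀ k, A k ∈ Matrix.rowStochastic ℝ (Fin m))
    (hB : ∀ k, B k ∈ Matrix.rowStochastic ℝ (Fin m))
    (hAB : ∀ i j, Summable fun k => |A k i j - B k i j|) {i j : Fin m}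
    (h : InfiniteFlow A i j) : InfiniteFlow B i j := by
  rw [infiniteFlow_iff hA] at h
  rw [infiniteFlow_iff hB]
  refine fun hs => h ?_
  have := (hs.add (hAB i j).of_abs).add (hAB j i).of_abs
  refine this.congr fun k => ?_
  ring

/-- If the total flow across a cut is finite, a trajectory started late enough from the indicator
of the cut stays close to that indicator. -/
theorem exists_trajectory_separating {A : ℕ → Matrix (Fin m) (Fin m) ℝ}
    (hA : ∀ k, A k ∈ Matrix.rowStochastic ℝ (Fin m)) {S : Set (Fin m)}
    (hS : ∀ a ∈ S, ∀ b ∉ S, Summable fun k => A k a b + A k b a) :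
    ∃ T x, IsTrajectory A T x ∧
      ∀ k, T ≤ k → (∀ a ∈ S, 3 / 4 ≤ x k a) ∧ ∀ b ∉ S, x k b ≤ 1 / 4 := by
  classical
  set f : ℕ → ℝ := fun k => ∑ a, ∑ b, if a ∈ S ∧ b ∉ S then A k a b + A k b a else 0 with hf
  have hnn : ∀ k a b, 0 ≤ A k a b := fun k a b => Matrix.nonneg_of_mem_rowStochastic (hA k)
  have hterm : ∀ k a b, 0 ≤ if a ∈ S ∧ b ∉ S then A k a b + A k b a else 0 := by
    intro k a b
    split_ifs
    · exact add_nonneg (hnn _ _ _) (hnn _ _ _)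
    · exact le_rfl
  have hf0 : ∀ k, 0 ≤ f k := fun k =>
    Finset.sum_nonneg fun a _ => Finset.sum_nonneg fun b _ => hterm k a b
  have hsum : Summable f := by
    refine summable_sum fun a _ => summable_sum fun b _ => ?_
    by_cases h : a ∈ S ∧ b ∉ S
    · simpa only [if_pos h] using hS a h.1 b h.2
    · simpa only [if_neg h] using summable_zero
  obtain ⟨T, hT⟩ := ((tendsto_sum_nat_add f).eventually
    (gt_mem_nhds (show (0 : ℝ) < 1 / 4 by norm_num))).exists
  have hout : ∀ k, ∀ a ∈ S, ∑ b, (if b ∈ S then 0 else A k a b) ≤ f k := by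
    intro k a ha
    refine le_trans (Finset.sum_le_sum fun b _ => ?_) (Finset.single_le_sum
      (f := fun a => ∑ b, if a ∈ S ∧ b ∉ S then A k a b + A k b a else 0)
      (fun a _ => Finset.sum_nonneg fun b _ => hterm k a b) (Finset.mem_univ a))
    by_cases hb : b ∈ S
    · simp [hb]
    · simp [hb, ha, hnn k b a]
  have hinto : ∀ k, ∀ b ∉ S, ∑ a, (if a ∈ S then A k b a else 0) ≤ f k := by
    intro k b hb
    rw [hf]
    simp only
    rw [Finset.sum_comm]
    refine le_trans (Finset.sum_le_sum fun a _ => ?_) (Finset.single_le_sum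
      (f := fun b => ∑ a, if a ∈ S ∧ b ∉ S then A k a b + A k b a else 0)
      (fun b _ => Finset.sum_nonneg fun a _ => hterm k a b) (Finset.mem_univ b))
    by_cases ha : a ∈ S
    · simp [hb, ha, hnn k a b]
    · simp [ha]
  set v : Fin m → ℝ := fun a => if a ∈ S then 1 else 0 with hv
  have hx := isTrajectory_transition A T v
  set x : ℕ → Fin m → ℝ := fun k => transition (fun k => A (T + k)) (k - T) *ᵥ v with hxdef
  have hx0 : x T = v := by simp [hxdef, transition]
  -- As values stay in [0, 1], weight crossing the cut changes a coordinate's bound by at most that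
  -- weight. The choice of T keeps the accumulated flow below 1/4.
  have hmain : ∀ n, (∀ a, 0 ≤ x (T + n) a ∧ x (T + n) a ≤ 1) ∧
      (∀ a ∈ S, 1 - ∑ s ∈ Finset.range n, f (s + T) ≤ x (T + n) a) ∧
      ∀ b ∉ S, x (T + n) b ≤ ∑ s ∈ Finset.range n, f (s + T) := by
    intro n
    induction n with
    | zero =>
      simp only [add_zero, hx0, Finset.range_zero, Finset.sum_empty, sub_zero]
      refine ⟨fun a => ?_, fun a ha => ?_, fun b hb => ?_⟩
      · by_cases ha : a ∈ S <;> simp [hv, ha]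
      · simp [hv, ha]
      · simp [hv, hb]
    | succ n ih =>
      obtain ⟨h01, hin, hoff⟩ := ih
      set σ := ∑ s ∈ Finset.range n, f (s + T) with hσ
      have hσ0 : 0 ≤ σ := Finset.sum_nonneg fun s _ => hf0 _
      have hstep : ∀ a, x (T + (n + 1)) a = ∑ b, A (T + n) a b * x (T + n) b := by
        intro a
        rw [← add_assoc, hx _ (by omega)]
        rfl
      have hrow : ∀ a, ∑ b, A (T + n) a b = 1 := fun a =>
        Matrix.sum_row_of_mem_rowStochastic (hA _) a
      rw [Finset.sum_range_succ, ← hσ, add_comm n T]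
      refine ⟨fun a => ⟨?_, ?_⟩, fun a ha => ?_, fun b hb => ?_⟩
      · rw [hstep]
        exact Finset.sum_nonneg fun b _ => mul_nonneg (hnn _ _ _) (h01 b).1
      · rw [hstep, ← hrow a]
        exact Finset.sum_le_sum fun b _ => mul_le_of_le_one_right (hnn _ _ _) (h01 b).2
      · have hle : ∑ b, (A (T + n) a b * (1 - σ) - if b ∈ S then 0 else A (T + n) a b) ≤
            x (T + (n + 1)) a := by
          rw [hstep]
          refine Finset.sum_le_sum fun b _ => ?_
          by_cases hb : b ∈ S
          · simp only [hb, if_true, sub_zero]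
            exact mul_le_mul_of_nonneg_left (hin b hb) (hnn _ _ _)
          · simp only [hb, if_false]
            nlinarith [hnn (T + n) a b, mul_nonneg (hnn (T + n) a b) (h01 b).1,
              mul_nonneg (hnn (T + n) a b) hσ0]
        rw [Finset.sum_sub_distrib, ← Finset.sum_mul, hrow] at hle
        linarith [hout (T + n) a ha]
      · have hle : x (T + (n + 1)) b ≤
            ∑ a, (A (T + n) b a * σ + if a ∈ S then A (T + n) b a else 0) := by
          rw [hstep]
          refine Finset.sum_le_sum fun a _ => ?_
          by_cases ha : a ∈ S
          · simp only [ha, if_true]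
            nlinarith [mul_nonneg (hnn (T + n) b a) hσ0,
              mul_le_of_le_one_right (hnn (T + n) b a) (h01 a).2]
          · simp only [ha, if_false, add_zero]
            exact mul_le_mul_of_nonneg_left (hoff a ha) (hnn _ _ _)
        rw [Finset.sum_add_distrib, ← Finset.sum_mul, hrow] at hle
        linarith [hinto (T + n) b hb]
  refine ⟨T, x, hx, fun k hk => ?_⟩
  obtain ⟨n, rfl⟩ := Nat.exists_eq_add_of_le hk
  obtain ⟨-, hin, hoff⟩ := hmain n
  have hle : ∑ s ∈ Finset.range n, f (s + T) ≤ 1 / 4 :=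
    (Summable.sum_le_tsum _ (fun s _ => hf0 _) ((summable_nat_add_iff T).2 hsum)).trans hT.le
  exact ⟨fun a ha => by linarith [hin a ha], fun b hb => (hoff b hb).trans hle⟩

/-- Mutually weakly ergodic indices are connected in the infinite flow graph. -/
theorem MutuallyWeaklyErgodic.reachable {A : ℕ → Matrix (Fin m) (Fin m) ℝ}
    (hA : ∀ k, A k ∈ Matrix.rowStochastic ℝ (Fin m)) {i j : Fin m}
    (h : MutuallyWeaklyErgodic A i j) : (flowGraph A).Reachable i j := by
  by_contra hij
  -- No edge leaves the set reachable from i, so every pair across this cut has finite flow.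
  obtain ⟨T, x, hx, hsep⟩ := exists_trajectory_separating hA
    (S := {a | (flowGraph A).Reachable i a}) (by
      intro a ha b hb
      by_contra hns
      have hne : a ≠ b := fun e => hb (e ▸ ha)
      have hadj : (flowGraph A).Adj a b := ⟨hne, (infiniteFlow_iff hA).2 hns⟩
      exact hb (SimpleGraph.Reachable.trans ha hadj.reachable))
  have hlim := h T x hx
  have : (1 / 2 : ℝ) ≤ 0 := ge_of_tendsto hlim <| (eventually_ge_atTop T).mono fun k hk => by
    linarith [(hsep k hk).1 i (SimpleGraph.Reachable.refl i), (hsep k hk).2 j hij]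
  norm_num at this

end Deterministic

/-! ### The past of a random model -/

/-- The `σ`-algebra generated by `W(0), …, W(k-1)`. -/
@[reducible]
def past {m : ℕ} {Ω : Type*} (W : ℕ → Ω → Matrix (Fin m) (Fin m) ℝ) (k : ℕ) : MeasurableSpace Ω :=
  ⨆ s ∈ Set.Iio k,
    MeasurableSpace.comap (fun ω (p : Fin m × Fin m) => W s ω p.1 p.2) inferInstance

theorem past_mono {m : ℕ} {Ω : Type*} (W : ℕ → Ω → Matrix (Fin m) (Fin m) ℝ) : Monotone (past W) :=
  fun _ _ h => biSup_mono fun _ hs => lt_of_lt_of_le hs h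

theorem measurable_comap_entry {m : ℕ} {Ω : Type*}
    (W : ℕ → Ω → Matrix (Fin m) (Fin m) ℝ) (k : ℕ) (i j : Fin m) :
    Measurable[MeasurableSpace.comap (fun ω (p : Fin m × Fin m) => W k ω p.1 p.2) inferInstance]
      fun ω => W k ω i j :=
  (measurable_pi_apply (X := fun _ : Fin m × Fin m => ℝ) (i, j)).comp
    (comap_measurable fun ω (p : Fin m × Fin m) => W k ω p.1 p.2)

/-- The product up to time k involves only W(0), …, W(k-1); this is what makes it independent of
W(k). -/
theorem measurable_past_transition {m : ℕ} {Ω : Type*}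
    (W : ℕ → Ω → Matrix (Fin m) (Fin m) ℝ) (k : ℕ) (i l : Fin m) :
    Measurable[past W k] fun ω => transition (fun k => W k ω) k i l := by
  induction k generalizing i with
  | zero => exact measurable_const
  | succ k ih =>
    simp only [transition_succ_apply]
    refine Finset.measurable_fun_sum _ fun j _ => Measurable.mul ?_ ?_
    · exact (measurable_comap_entry W k i j).mono
        (le_iSup₂_of_le k (Set.mem_Iio.2 k.lt_succ_self) le_rfl) le_rfl
    · exact (ih j).mono (past_mono W k.le_succ) le_rfl

section Random

variable {m : ℕ} {Ω : Type*} [MeasurableSpace Ω] {μ : Measure Ω}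

/-! ### Summability of random series -/

/-- A series of nonnegative random variables with summable expectations converges almost surely. -/
theorem ae_summable_of_summable_integral {f : ℕ → Ω → ℝ} (hf0 : ∀ k ω, 0 ≤ f k ω)
    (hfm : ∀ k, Measurable (f k)) (hfi : ∀ k, Integrable (f k) μ)
    (hs : Summable fun k => ∫ ω, f k ω ∂μ) : ∀ᵐ ω ∂μ, Summable fun k => f k ω := by
  have hmeas : ∀ k, Measurable fun ω => ENNReal.ofReal (f k ω) := fun k => (hfm k).ennreal_ofReal
  have hfin : ∫⁻ ω, ∑' k, ENNReal.ofReal (f k ω) ∂μ ≠ ∞ := by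
    rw [lintegral_tsum fun k => (hmeas k).aemeasurable]
    have : ∀ k, ∫⁻ ω, ENNReal.ofReal (f k ω) ∂μ = ENNReal.ofReal (∫ ω, f k ω ∂μ) := fun k =>
      (ofReal_integral_eq_lintegral_ofReal (hfi k) (Eventually.of_forall (hf0 k))).symm
    simp only [this]
    exact hs.tsum_ofReal_ne_top
  filter_upwards [ae_lt_top (Measurable.tsum hmeas) hfin] with ω hω
  by_contra hns
  exact hω.ne ((tsum_ofReal_eq_top_iff fun k => hf0 k ω).2 hns)

/-- On [0, 1], (1 - y/2)(1 + y) ≥ 1. Averaging the bound gives E exp(-ξ) ≤ 1 - E ξ / 2 ≤ exp(-E ξ /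
2). -/
theorem exp_neg_le_one_sub_half {y : ℝ} (h0 : 0 ≤ y) (h1 : y ≤ 1) :
    Real.exp (-y) ≤ 1 - y / 2 := by
  have h : (1 - y / 2) * Real.exp y ≥ 1 := by nlinarith [Real.add_one_le_exp y]
  rw [Real.exp_neg, inv_le_iff_one_le_mul₀ (Real.exp_pos y)]
  linarith

/-- A series of independent `[0, 1]`-valued random variables with divergent expectations diverges
almost surely. -/
theorem ae_not_summable_of_iIndepFun [IsProbabilityMeasure μ] {ξ : ℕ → Ω → ℝ}
    (hind : iIndepFun ξ μ) (hm : ∀ k, Measurable (ξ k)) (h0 : ∀ k ω, 0 ≤ ξ k ω)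
    (h1 : ∀ k ω, ξ k ω ≤ 1) (hns : ¬ Summable fun k => ∫ ω, ξ k ω ∂μ) :
    ∀ᵐ ω ∂μ, ¬ Summable fun k => ξ k ω := by
  have hξi : ∀ k, Integrable (ξ k) μ := fun k =>
    Integrable.of_bound (hm k).aestronglyMeasurable 1 (Eventually.of_forall fun ω => by
      rw [Real.norm_of_nonneg (h0 k ω)]; exact h1 k ω)
  have hE0 : ∀ k, 0 ≤ ∫ ω, ξ k ω ∂μ := fun k => integral_nonneg (h0 k)
  have hem : ∀ k, Measurable fun ω => Real.exp (-ξ k ω) := fun k => (hm k).neg.exp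
  have hei : ∀ k, Integrable (fun ω => Real.exp (-ξ k ω)) μ := fun k =>
    Integrable.of_bound (hem k).aestronglyMeasurable 1 (Eventually.of_forall fun ω => by
      rw [Real.norm_of_nonneg (Real.exp_pos _).le, Real.exp_le_one_iff]
      linarith [h0 k ω])
  -- F is exp of minus the partial sum. Independence sends its expectation to zero, whereas wherever
  -- the series converges F stays above a positive constant.
  set F : ℕ → Ω → ℝ := fun n ω => ∏ k ∈ Finset.range n, Real.exp (-ξ k ω) with hF
  have hF0 : ∀ n ω, 0 ≤ F n ω := fun n ω => Finset.prod_nonneg fun k _ => (Real.exp_pos _).le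
  have hFm : ∀ n, Measurable (F n) := fun n => Finset.measurable_fun_prod _ fun k _ => hem k
  have hFi : ∀ n, Integrable (F n) μ := fun n =>
    Integrable.of_bound (hFm n).aestronglyMeasurable 1 (Eventually.of_forall fun ω => by
      rw [Real.norm_of_nonneg (hF0 n ω)]
      refine Finset.prod_le_one (fun k _ => (Real.exp_pos _).le) fun k _ => ?_
      rw [Real.exp_le_one_iff]
      linarith [h0 k ω])
  have hbound : ∀ n, ∫ ω, F n ω ∂μ ≤ Real.exp (-(∑ k ∈ Finset.range n, ∫ ω, ξ k ω ∂μ) / 2) := by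
    intro n
    have hprod : ∫ ω, F n ω ∂μ = ∏ k ∈ Finset.range n, ∫ ω, Real.exp (-ξ k ω) ∂μ := by
      simp only [hF, Finset.prod_range]
      have hind' : iIndepFun (fun (k : Fin n) ω => Real.exp (-ξ k ω)) μ :=
        (hind.comp (fun _ t => Real.exp (-t)) fun _ => measurable_neg.exp).precomp
          Fin.val_injective
      exact hind'.integral_fun_prod_eq_prod_integral fun k => (hem k).aestronglyMeasurable
    rw [hprod, neg_div, Finset.sum_div, ← Finset.sum_neg_distrib, Real.exp_sum]
    refine Finset.prod_le_prod (fun k _ => integral_nonneg fun ω => (Real.exp_pos _).le)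
      fun k _ => ?_
    calc ∫ ω, Real.exp (-ξ k ω) ∂μ ≤ ∫ ω, (1 - ξ k ω / 2) ∂μ :=
          integral_mono (hei k) ((integrable_const _).sub ((hξi k).div_const 2))
            fun ω => exp_neg_le_one_sub_half (h0 k ω) (h1 k ω)
      _ = 1 - (∫ ω, ξ k ω ∂μ) / 2 := by
          rw [integral_sub (integrable_const _) ((hξi k).div_const 2), integral_div]
          simp
      _ ≤ _ := by linarith [Real.add_one_le_exp (-((∫ ω, ξ k ω ∂μ) / 2))]
  have hlim : Tendsto (fun n => ENNReal.ofReal (∫ ω, F n ω ∂μ)) atTop (𝓝 0) := by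
    rw [← ENNReal.ofReal_zero]
    refine ENNReal.tendsto_ofReal (squeeze_zero (fun n => integral_nonneg (hF0 n)) hbound ?_)
    refine Real.tendsto_exp_atBot.comp ?_
    simp only [neg_div]
    exact tendsto_neg_atTop_atBot.comp
      (((not_summable_iff_tendsto_nat_atTop_of_nonneg hE0).1 hns).atTop_div_const two_pos)
  have hzero : ∫⁻ ω, ⨅ n, ENNReal.ofReal (F n ω) ∂μ = 0 := by
    refine le_antisymm (ge_of_tendsto' hlim fun n => ?_) zero_le
    rw [ofReal_integral_eq_lintegral_ofReal (hFi n) (Eventually.of_forall (hF0 n))]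
    exact lintegral_mono fun ω => iInf_le _ n
  rw [lintegral_eq_zero_iff (Measurable.iInf fun n => (hFm n).ennreal_ofReal)] at hzero
  filter_upwards [hzero] with ω hω hsum
  have hpos : ENNReal.ofReal (Real.exp (-∑' k, ξ k ω)) ≤ ⨅ n, ENNReal.ofReal (F n ω) := by
    refine le_iInf fun n => ENNReal.ofReal_le_ofReal ?_
    simp only [hF]
    rw [← Real.exp_sum, Finset.sum_neg_distrib, Real.exp_le_exp, neg_le_neg_iff]
    exact Summable.sum_le_tsum _ (fun k _ => h0 k ω) hsum
  rw [hω] at hpos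
  simp only [Pi.zero_apply, nonpos_iff_eq_zero, ENNReal.ofReal_eq_zero] at hpos
  exact absurd hpos (not_le.2 (Real.exp_pos _))

/-! ### Random models -/

namespace IsRandomModel

variable {W : ℕ → Ω → Matrix (Fin m) (Fin m) ℝ}

theorem measurable_entries (hW : IsRandomModel W) (k : ℕ) :
    Measurable fun ω (p : Fin m × Fin m) => W k ω p.1 p.2 :=
  measurable_pi_lambda _ fun p => hW.measurable k p.1 p.2

theorem past_le (hW : IsRandomModel W) (k : ℕ) : past W k ≤ ‹MeasurableSpace Ω› :=
  iSup₂_le fun s _ => (hW.measurable_entries s).comap_le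

theorem nonneg (hW : IsRandomModel W) (k : ℕ) (ω : Ω) (i j : Fin m) : 0 ≤ W k ω i j :=
  Matrix.nonneg_of_mem_rowStochastic (hW.stochastic k ω)

theorem le_one (hW : IsRandomModel W) (k : ℕ) (ω : Ω) (i j : Fin m) : W k ω i j ≤ 1 :=
  Matrix.le_one_of_mem_rowStochastic (hW.stochastic k ω)

theorem sum_row (hW : IsRandomModel W) (k : ℕ) (ω : Ω) (i : Fin m) : ∑ j, W k ω i j = 1 :=
  Matrix.sum_row_of_mem_rowStochastic (hW.stochastic k ω) i

theorem abs_le_one (hW : IsRandomModel W) (k : ℕ) (ω : Ω) (i j : Fin m) : |W k ω i j| ≤ 1 := by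
  rw [abs_of_nonneg (hW.nonneg k ω i j)]
  exact hW.le_one k ω i j

theorem integrable [IsProbabilityMeasure μ] (hW : IsRandomModel W) (k : ℕ) (i j : Fin m) :
    Integrable (fun ω => W k ω i j) μ :=
  Integrable.of_bound (hW.measurable k i j).aestronglyMeasurable 1
    (Eventually.of_forall fun ω => hW.abs_le_one k ω i j)

theorem shift (hW : IsRandomModel W) (t : ℕ) : IsRandomModel fun k => W (t + k) :=
  ⟨fun k => hW.measurable (t + k), fun k => hW.stochastic (t + k)⟩

theorem expectedChain_mem [IsProbabilityMeasure μ] (hW : IsRandomModel W) (k : ℕ) :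
    expectedChain μ W k ∈ Matrix.rowStochastic ℝ (Fin m) := by
  rw [Matrix.mem_rowStochastic_iff_sum]
  refine ⟨fun i j => integral_nonneg fun ω => hW.nonneg k ω i j, fun i => ?_⟩
  simp only [expectedChain, Matrix.of_apply]
  rw [← integral_finsetSum _ fun j _ => hW.integrable k i j]
  simp [hW.sum_row]

/-- The filtration of the pasts of a random model. -/
def filtration (hW : IsRandomModel W) : Filtration ℕ ‹MeasurableSpace Ω› where
  seq := past W
  mono' := past_mono W
  le' := hW.past_le

theorem abs_transition_le_one (hW : IsRandomModel W) (k : ℕ) (ω : Ω) (i l : Fin m) :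
    |transition (fun k => W k ω) k i l| ≤ 1 :=
  RandomChain.abs_transition_le_one (fun k => hW.stochastic k ω) k i l

end IsRandomModel

/-! ### Independent models and their expected chains. -/

namespace IsIndependentModel

variable {W : ℕ → Ω → Matrix (Fin m) (Fin m) ℝ}

/-- Ergodicity concerns every starting time; shifting reduces each of them to time zero. -/
theorem shift (hW : IsIndependentModel μ W) (t : ℕ) :
    IsIndependentModel μ fun k => W (t + k) :=
  ⟨hW.toIsRandomModel.shift t, hW.indep.precomp (add_right_injective t)⟩

/-- Expectations of products of a function of the past and a function of the present factor. -/
theorem integral_mul (hW : IsIndependentModel μ W) {k : ℕ} {Z Y : Ω → ℝ}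
    (hZ : Measurable[past W k] Z)
    (hY : Measurable[MeasurableSpace.comap (fun ω (p : Fin m × Fin m) => W k ω p.1 p.2)
      inferInstance] Y) :
    ∫ ω, Z ω * Y ω ∂μ = (∫ ω, Z ω ∂μ) * ∫ ω, Y ω ∂μ := by
  have hle : ∀ s, MeasurableSpace.comap (fun ω (p : Fin m × Fin m) => W s ω p.1 p.2)
      inferInstance ≤ ‹MeasurableSpace Ω› := fun s => (hW.measurable_entries s).comap_le
  have hind := indep_iSup_of_disjoint hle hW.indep.iIndep
    (S := Set.Iio k) (T := {k}) (by simp)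
  simp only [Set.mem_singleton_iff, iSup_iSup_eq_left] at hind
  have hZY : IndepFun Z Y μ := by
    rw [IndepFun_iff_Indep]
    exact indep_of_indep_of_le_left (indep_of_indep_of_le_right hind hY.comap_le) hZ.comap_le
  exact hZY.integral_fun_mul_eq_mul_integral (hZ.mono (hW.past_le k) le_rfl).aestronglyMeasurable
    (hY.mono (hle k) le_rfl).aestronglyMeasurable

/-- Each new factor is independent of the product before it, so the expectation factors one step at
a time. -/
theorem integral_transition [IsProbabilityMeasure μ] (hW : IsIndependentModel μ W) (k : ℕ)
    (i l : Fin m) :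
    ∫ ω, transition (fun k => W k ω) k i l ∂μ = transition (expectedChain μ W) k i l := by
  induction k generalizing i with
  | zero => simp [transition]
  | succ k ih =>
    simp only [transition_succ_apply]
    have hm : ∀ j, Measurable fun ω => transition (fun k => W k ω) k j l := fun j =>
      (measurable_past_transition W k j l).mono (hW.past_le k) le_rfl
    rw [integral_finsetSum]
    · refine Finset.sum_congr rfl fun j _ => ?_
      simp only [mul_comm (W k _ i j)]
      rw [hW.integral_mul (measurable_past_transition W k j l) (measurable_comap_entry W k i j),
        ih, mul_comm]
      rfl
    · intro j _
      refine Integrable.of_bound ((hW.measurable k i j).mul (hm j)).aestronglyMeasurable 1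
        (Eventually.of_forall fun ω => ?_)
      rw [norm_mul]
      exact mul_le_one₀ (hW.abs_le_one k ω i j) (norm_nonneg _)
        (hW.abs_transition_le_one k ω j l)

/-- Almost sure mutual ergodicity passes to the expected chain. -/
theorem mutuallyErgodic_expectedChain [IsProbabilityMeasure μ] (hW : IsIndependentModel μ W)
    {i j : Fin m} (h : ∀ᵐ ω ∂μ, MutuallyErgodic (fun k => W k ω) i j) :
    MutuallyErgodic (expectedChain μ W) i j := by
  have hm : ∀ t k i l, Measurable fun ω => transition (fun k => W (t + k) ω) k i l :=
    fun t k i l => (measurable_past_transition (fun k => W (t + k)) k i l).mono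
      ((hW.shift t).past_le k) le_rfl
  have hb : ∀ t k i l ω, |transition (fun k => W (t + k) ω) k i l| ≤ 1 :=
    fun t k i l ω => (hW.shift t).abs_transition_le_one k ω i l
  have hE : ∀ t k i l, ∫ ω, transition (fun k => W (t + k) ω) k i l ∂μ =
      transition (fun k => expectedChain μ W (t + k)) k i l :=
    fun t k i l => (hW.shift t).integral_transition k i l
  have hlim : ∀ i, (∀ᵐ ω ∂μ, ErgodicIndex (fun k => W k ω) i) →
      ErgodicIndex (expectedChain μ W) i := by
    intro i hi
    refine ergodicIndex_iff_transition.2 fun t l => ?_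
    -- `limUnder` is the true limit wherever i is ergodic, hence almost everywhere.
    refine ⟨∫ ω, limUnder atTop (fun k => transition (fun k => W (t + k) ω) k i l) ∂μ, ?_⟩
    simp only [← hE]
    refine tendsto_integral_of_dominated_convergence (fun _ => 1)
      (fun k => (hm t k i l).aestronglyMeasurable) (integrable_const _)
      (fun k => Eventually.of_forall (hb t k i l)) ?_
    filter_upwards [hi] with ω hω
    exact tendsto_nhds_limUnder (ergodicIndex_iff_transition.1 hω t l)
  refine ⟨hlim i (h.mono fun ω hω => hω.1), hlim j (h.mono fun ω hω => hω.2.1), ?_⟩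
  refine mutuallyWeaklyErgodic_iff_transition.2 fun t l => ?_
  have hint : ∀ k i, Integrable (fun ω => transition (fun k => W (t + k) ω) k i l) μ := fun k i =>
    Integrable.of_bound (hm t k i l).aestronglyMeasurable 1
      (Eventually.of_forall (hb t k i l))
  simp only [← hE, ← integral_sub (hint _ i) (hint _ j)]
  rw [← integral_zero Ω ℝ (μ := μ)]
  refine tendsto_integral_of_dominated_convergence (fun _ => 2)
    (fun k => ((hm t k i l).sub (hm t k j l)).aestronglyMeasurable) (integrable_const _)
    (fun k => Eventually.of_forall fun ω => ?_) ?_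
  · refine (norm_sub_le _ _).trans ?_
    have h₁ := hb t k i l ω
    have h₂ := hb t k j l ω
    rw [Real.norm_eq_abs, Real.norm_eq_abs]
    linarith
  · filter_upwards [h] with ω hω
    exact mutuallyWeaklyErgodic_iff_transition.1 hω.2.2 t l

/-- Infinite expected flow forces infinite flow almost surely. -/
theorem ae_infiniteFlow [IsProbabilityMeasure μ] (hW : IsIndependentModel μ W) {i j : Fin m}
    (h : InfiniteFlow (expectedChain μ W) i j) :
    ∀ᵐ ω ∂μ, InfiniteFlow (fun k => W k ω) i j := by
  rw [infiniteFlow_iff hW.expectedChain_mem] at h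
  have hind : iIndepFun (fun k ω => (W k ω i j + W k ω j i) / 2) μ :=
    hW.indep.comp (fun _ w => (w (i, j) + w (j, i)) / 2) fun _ => by
      fun_prop
  have hae := ae_not_summable_of_iIndepFun hind
    (fun k => ((hW.measurable k i j).add (hW.measurable k j i)).div_const 2)
    (fun k ω => by have := hW.nonneg k ω i j; have := hW.nonneg k ω j i; positivity)
    (fun k ω => by linarith [hW.le_one k ω i j, hW.le_one k ω j i]) (fun hs => h (by
      refine (hs.mul_left 2).congr fun k => ?_
      rw [integral_div, integral_add (hW.integrable k i j) (hW.integrable k j i)]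
      simp only [expectedChain, Matrix.of_apply]
      ring))
  filter_upwards [hae] with ω hω
  rw [infiniteFlow_iff fun k => hW.stochastic k ω]
  exact fun hs => hω (hs.div_const 2)

end IsIndependentModel

end Random

section Stability

/-! ### Stability of models with a steady state and weak feedback -/

variable {m : ℕ} {Ω : Type*} [MeasurableSpace Ω] {μ : Measure Ω}
  {U : ℕ → Ω → Matrix (Fin m) (Fin m) ℝ}

theorem sum_mul_sq_sub_sq {p : Fin m → ℝ} (hp : ∑ j, p j = 1) (x : Fin m → ℝ) :
    ∑ j, p j * x j ^ 2 - (∑ j, p j * x j) ^ 2 =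
      1 / 2 * ∑ j, ∑ h, p j * p h * (x j - x h) ^ 2 := by
  have e : ∀ j h, p j * p h * (x j - x h) ^ 2 =
      p j * x j ^ 2 * p h + p j * (p h * x h ^ 2) - 2 * (p j * x j * (p h * x h)) :=
    fun j h => by ring
  simp only [e, Finset.sum_sub_distrib, Finset.sum_add_distrib, ← Finset.mul_sum,
    ← Finset.sum_mul, hp]
  ring

/-- Of the variance, written as a double sum over pairs, only the ordered pair (a, b) is kept. -/
theorem sq_sum_add_le {p : Fin m → ℝ} (hp0 : ∀ j, 0 ≤ p j) (hp : ∑ j, p j = 1) (x : Fin m → ℝ)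
    (a b : Fin m) :
    (∑ j, p j * x j) ^ 2 + 1 / 2 * (p a * p b * (x a - x b) ^ 2) ≤ ∑ j, p j * x j ^ 2 := by
  have hnn : ∀ j h, 0 ≤ p j * p h * (x j - x h) ^ 2 := fun j h =>
    mul_nonneg (mul_nonneg (hp0 j) (hp0 h)) (sq_nonneg _)
  have h₁ := Finset.single_le_sum (f := fun h => p a * p h * (x a - x h) ^ 2)
    (fun h _ => hnn a h) (Finset.mem_univ b)
  have h₂ := Finset.single_le_sum (f := fun j => ∑ h, p j * p h * (x j - x h) ^ 2)
    (fun j _ => Finset.sum_nonneg fun h _ => hnn j h) (Finset.mem_univ a)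
  have h₃ := sum_mul_sq_sub_sq hp x
  linarith

theorem sq_sum_le {p : Fin m → ℝ} (hp0 : ∀ j, 0 ≤ p j) (hp : ∑ j, p j = 1) (x : Fin m → ℝ) :
    (∑ j, p j * x j) ^ 2 ≤ ∑ j, p j * x j ^ 2 := by
  have h := sum_mul_sq_sub_sq hp x
  have : 0 ≤ ∑ j, ∑ h, p j * p h * (x j - x h) ^ 2 :=
    Finset.sum_nonneg fun j _ => Finset.sum_nonneg fun h _ =>
      mul_nonneg (mul_nonneg (hp0 j) (hp0 h)) (sq_nonneg _)
  linarith

/-- Averaging a function of the past against a steady state in expectation. -/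
theorem IsCommonSteadyState.sum_integral {π : Fin m → ℝ} (hπ : IsCommonSteadyState μ U π)
    (hU : IsIndependentModel μ U) {k : ℕ} {Z : Fin m → Ω → ℝ}
    (hZ : ∀ j, Measurable[past U k] (Z j)) :
    ∑ i, ∑ j, π i * ∫ ω, Z j ω * U k ω i j ∂μ = ∑ j, π j * ∫ ω, Z j ω ∂μ := by
  rw [Finset.sum_comm]
  refine Finset.sum_congr rfl fun j _ => ?_
  have hj : ∑ i, π i * ∫ ω, U k ω i j ∂μ = π j := congrFun (hπ k) j
  rw [← hj, Finset.sum_mul]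
  refine Finset.sum_congr rfl fun i _ => ?_
  rw [hU.integral_mul (hZ j) (measurable_comap_entry U k i j)]
  ring

variable [IsProbabilityMeasure μ]

theorem IsRandomModel.integrable_of_past (hU : IsRandomModel U) {k : ℕ} {Z : Ω → ℝ}
    (hZ : Measurable[past U k] Z) {C : ℝ} (hC : ∀ ω, |Z ω| ≤ C) : Integrable Z μ :=
  Integrable.of_bound (hZ.mono (hU.past_le k) le_rfl).aestronglyMeasurable C
    (Eventually.of_forall hC)

theorem IsRandomModel.integrable_past_mul (hU : IsRandomModel U) {k : ℕ} {Z : Ω → ℝ}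
    (hZ : Measurable[past U k] Z) {C : ℝ} (hC : ∀ ω, |Z ω| ≤ C) (i j : Fin m) :
    Integrable (fun ω => Z ω * U k ω i j) μ :=
  Integrable.of_bound
    ((hZ.mono (hU.past_le k) le_rfl).mul (hU.measurable k i j)).aestronglyMeasurable C
    (Eventually.of_forall fun ω => by
      rw [norm_mul]
      exact (mul_le_of_le_one_right (norm_nonneg _) (hU.abs_le_one k ω i j)).trans (hC ω))

/-- The weighted absolute deviation of a column of the transition matrix is a supermartingale. -/
theorem IsIndependentModel.supermartingale_weighted_abs (hU : IsIndependentModel μ U)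
    {π : Fin m → ℝ} (hπ0 : ∀ i, 0 < π i) (hπ : IsCommonSteadyState μ U π) (l : Fin m) (c : ℝ) :
    Supermartingale (fun k ω => ∑ j, π j * |transition (fun k => U k ω) k j l - c|)
      hU.filtration μ := by
  have hmeas : ∀ k j, Measurable[past U k] fun ω => |transition (fun k => U k ω) k j l - c| := by
    intro k j
    exact continuous_abs.measurable.comp ((measurable_past_transition U k j l).sub_const c)
  have hbdd : ∀ k j ω, |transition (fun k => U k ω) k j l - c| ≤ 1 + |c| := fun k j ω =>
    (abs_sub _ _).trans (by linarith [hU.abs_transition_le_one k ω j l])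
  have hint : ∀ k j, Integrable (fun ω => |transition (fun k => U k ω) k j l - c|) μ :=
    fun k j => hU.integrable_of_past (hmeas k j) (C := 1 + |c|) fun ω => by
      rw [abs_abs]; exact hbdd k j ω
  have hadapt : ∀ k, Measurable[past U k]
      fun ω => ∑ j, π j * |transition (fun k => U k ω) k j l - c| := fun k =>
    Finset.measurable_fun_sum _ fun j _ => (hmeas k j).const_mul _
  refine supermartingale_of_setIntegral_succ_le (fun k => ?_)
    (fun k => integrable_finsetSum _ fun j _ => (hint k j).const_mul _) fun k s hs => ?_
  · exact Measurable.stronglyMeasurable (hadapt k)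
  have hs' : MeasurableSet s := hU.past_le k s hs
  -- The past event s is absorbed into a past-measurable variable, so that stationarity applies on
  -- s.
  set Z : Fin m → Ω → ℝ := fun j =>
    s.indicator fun ω => |transition (fun k => U k ω) k j l - c| with hZdef
  have hZ : ∀ j, Measurable[past U k] (Z j) := fun j => (hmeas k j).indicator hs
  have hZ0 : ∀ j ω, 0 ≤ Z j ω := fun j ω => Set.indicator_nonneg (fun _ _ => abs_nonneg _) ω
  have hZb : ∀ j ω, |Z j ω| ≤ 1 + |c| := by
    intro j ω
    rw [abs_of_nonneg (hZ0 j ω)]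
    exact (Set.indicator_le_self' (fun _ _ => abs_nonneg _) ω).trans (hbdd k j ω)
  rw [← integral_indicator hs']
  calc ∫ ω, s.indicator (fun ω => ∑ j, π j * |transition (fun k => U k ω) (k + 1) j l - c|) ω ∂μ
      ≤ ∫ ω, ∑ i, ∑ j, π i * (Z j ω * U k ω i j) ∂μ := by
        refine integral_mono
          ((integrable_finsetSum _ fun j _ => (hint (k + 1) j).const_mul _).indicator hs')
          (integrable_finsetSum _ fun i _ => integrable_finsetSum _ fun j _ =>
            (hU.integrable_past_mul (hZ j) (hZb j) i j).const_mul _) fun ω => ?_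
        by_cases hω : ω ∈ s
        · simp only [hZdef, Set.indicator_of_mem hω, ← Finset.mul_sum]
          refine Finset.sum_le_sum fun i _ => mul_le_mul_of_nonneg_left ?_ (hπ0 i).le
          -- Rows sum to one, so c moves inside the average and the triangle inequality applies.
          have e : transition (fun k => U k ω) (k + 1) i l - c =
              ∑ j, U k ω i j * (transition (fun k => U k ω) k j l - c) := by
            simp only [mul_sub, Finset.sum_sub_distrib, ← Finset.sum_mul, hU.sum_row, one_mul]
            rfl
          rw [e]
          refine (Finset.abs_sum_le_sum_abs _ _).trans (Finset.sum_le_sum fun j _ => ?_)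
          rw [abs_mul, abs_of_nonneg (hU.nonneg k ω i j), mul_comm]
        · simp only [Set.indicator_of_notMem hω]
          exact Finset.sum_nonneg fun i _ => Finset.sum_nonneg fun j _ =>
            mul_nonneg (hπ0 i).le (mul_nonneg (hZ0 j ω) (hU.nonneg k ω i j))
    _ = ∑ i, ∑ j, π i * ∫ ω, Z j ω * U k ω i j ∂μ := by
        rw [integral_finsetSum _ fun i _ => integrable_finsetSum _ fun j _ =>
          (hU.integrable_past_mul (hZ j) (hZb j) i j).const_mul _]
        refine Finset.sum_congr rfl fun i _ => ?_
        rw [integral_finsetSum _ fun j _ =>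
          (hU.integrable_past_mul (hZ j) (hZb j) i j).const_mul _]
        simp only [integral_const_mul]
    _ = ∑ j, π j * ∫ ω, Z j ω ∂μ := hπ.sum_integral hU hZ
    _ = _ := by
        rw [integral_finsetSum _ fun j _ => ((hint k j).const_mul _).integrableOn]
        simp only [integral_const_mul, hZdef, integral_indicator hs']

/-- Martingale convergence for the negated process, a uniformly bounded submartingale. -/
theorem IsIndependentModel.ae_exists_tendsto_weighted_abs (hU : IsIndependentModel μ U)
    {π : Fin m → ℝ} (hπ0 : ∀ i, 0 < π i) (hπ : IsCommonSteadyState μ U π) (l : Fin m) (c : ℝ) :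
    ∀ᵐ ω ∂μ, ∃ L, Tendsto (fun k => ∑ j, π j * |transition (fun k => U k ω) k j l - c|)
      atTop (𝓝 L) := by
  have hsub := (hU.supermartingale_weighted_abs hπ0 hπ l c).neg
  have hbound : ∀ k ω, ∑ j, π j * |transition (fun k => U k ω) k j l - c| ≤
      ∑ j, π j * (1 + |c|) := fun k ω =>
    Finset.sum_le_sum fun j _ => mul_le_mul_of_nonneg_left
      ((abs_sub _ _).trans (by linarith [hU.abs_transition_le_one k ω j l])) (hπ0 j).le
  have hnn : ∀ k ω, 0 ≤ ∑ j, π j * |transition (fun k => U k ω) k j l - c| := fun k ω =>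
    Finset.sum_nonneg fun j _ => mul_nonneg (hπ0 j).le (abs_nonneg _)
  have hae := hsub.exists_ae_tendsto_of_bdd (R := Real.toNNReal (∑ j, π j * (1 + |c|)))
    fun k => by
      refine (eLpNorm_le_of_ae_bound (C := ∑ j, π j * (1 + |c|))
        (Eventually.of_forall fun ω => ?_)).trans ?_
      · rw [Pi.neg_apply, Pi.neg_apply, norm_neg, Real.norm_of_nonneg (hnn k ω)]
        exact hbound k ω
      · simp [ENNReal.ofReal]
  filter_upwards [hae] with ω hω
  obtain ⟨L, hL⟩ := hω
  exact ⟨-L, by simpa using hL.neg⟩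

/-- The expected energy dissipated along a single pair of indices is summable. -/
theorem IsIndependentModel.summable_integral_flow_mul_sq (hU : IsIndependentModel μ U)
    {π : Fin m → ℝ} (hπ0 : ∀ i, 0 < π i) (hπ : IsCommonSteadyState μ U π)
    (hfb : WeakFeedback μ U) (l : Fin m) {a b : Fin m} (hab : a ≠ b) :
    Summable fun k => ∫ ω, (transition (fun k => U k ω) k a l -
      transition (fun k => U k ω) k b l) ^ 2 * (U k ω a b + U k ω b a) ∂μ := by
  obtain ⟨γ, hγ, hfb⟩ := hfb
  have : Nonempty (Fin m) := ⟨a⟩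
  obtain ⟨i₀, hi₀⟩ := Finite.exists_min π
  set x : ℕ → Fin m → Ω → ℝ := fun k j ω => transition (fun k => U k ω) k j l with hx
  have hxm : ∀ k j, Measurable[past U k] (x k j) := fun k j => measurable_past_transition U k j l
  have hxb : ∀ k j ω, |x k j ω| ≤ 1 := fun k j ω => hU.abs_transition_le_one k ω j l
  have hsqm : ∀ k j, Measurable[past U k] fun ω => x k j ω ^ 2 := fun k j => (hxm k j).pow_const 2
  have hsqb : ∀ k j ω, |x k j ω ^ 2| ≤ 1 := fun k j ω => by
    rw [abs_pow]; exact pow_le_one₀ (abs_nonneg _) (hxb k j ω)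
  have hsqi : ∀ k j, Integrable (fun ω => x k j ω ^ 2) μ := fun k j =>
    hU.integrable_of_past (hsqm k j) (hsqb k j)
  have hDm : ∀ k, Measurable[past U k] fun ω => (x k a ω - x k b ω) ^ 2 := fun k =>
    ((hxm k a).sub (hxm k b)).pow_const 2
  have hDb : ∀ k ω, |(x k a ω - x k b ω) ^ 2| ≤ 4 := fun k ω => by
    have h₁ := abs_le.1 (hxb k a ω)
    have h₂ := abs_le.1 (hxb k b ω)
    rw [abs_of_nonneg (sq_nonneg _)]
    nlinarith [h₁.1, h₁.2, h₂.1, h₂.2]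
  have hD0 : ∀ k ω, 0 ≤ (x k a ω - x k b ω) ^ 2 := fun k ω => sq_nonneg _
  have hYm : ∀ k, Measurable[MeasurableSpace.comap
      (fun ω (p : Fin m × Fin m) => U k ω p.1 p.2) inferInstance]
      fun ω => ∑ i, U k ω i a * U k ω i b := fun k =>
    Finset.measurable_fun_sum _ fun i _ =>
      (measurable_comap_entry U k i a).mul (measurable_comap_entry U k i b)
  have hprod : ∀ k i, Integrable
      (fun ω => (x k a ω - x k b ω) ^ 2 * (U k ω i a * U k ω i b)) μ := fun k i =>
    Integrable.of_bound (((hDm k).mono (hU.past_le k) le_rfl).mul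
      ((hU.measurable k i a).mul (hU.measurable k i b))).aestronglyMeasurable 4
      (Eventually.of_forall fun ω => by
        rw [norm_mul, norm_mul]
        exact (mul_le_of_le_one_right (norm_nonneg _) (mul_le_one₀ (hU.abs_le_one k ω i a)
          (norm_nonneg _) (hU.abs_le_one k ω i b))).trans (hDb k ω))
  set E : ℕ → ℝ := fun k => ∑ i, π i * ∫ ω, x k i ω ^ 2 ∂μ with hE
  have hE0 : ∀ k, 0 ≤ E k := fun k => Finset.sum_nonneg fun i _ =>
    mul_nonneg (hπ0 i).le (integral_nonneg fun ω => sq_nonneg _)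
  set e : ℕ → ℝ := fun k => ∫ ω, (x k a ω - x k b ω) ^ 2 * (U k ω a b + U k ω b a) ∂μ with he
  have he0 : ∀ k, 0 ≤ e k := fun k => integral_nonneg fun ω =>
    mul_nonneg (hD0 k ω) (add_nonneg (hU.nonneg k ω a b) (hU.nonneg k ω b a))
  -- 1/2 comes from `sq_sum_add_le`, the smallest weight π i₀ bounds all weights below, and γ is the
  -- feedback constant.
  set κ : ℝ := 1 / 2 * π i₀ * γ with hκ
  have hκ0 : 0 < κ := by have := hπ0 i₀; positivity
  have hfeed : ∀ k, γ * e k ≤ ∑ i, ∫ ω, (x k a ω - x k b ω) ^ 2 * (U k ω i a * U k ω i b) ∂μ := by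
    intro k
    rw [← integral_finsetSum _ fun i _ => hprod k i]
    simp only [← Finset.mul_sum]
    have hflow : e k = (∫ ω, (x k a ω - x k b ω) ^ 2 ∂μ) * ∫ ω, U k ω a b + U k ω b a ∂μ :=
      hU.integral_mul (Y := fun ω => U k ω a b + U k ω b a) (hDm k)
        ((measurable_comap_entry U k a b).add (measurable_comap_entry U k b a))
    rw [hU.integral_mul (hDm k) (hYm k), hflow,
      integral_add (hU.integrable k a b) (hU.integrable k b a), mul_left_comm]
    exact mul_le_mul_of_nonneg_left (hfb k a b hab) (integral_nonneg (hD0 k))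
  have hdecr : ∀ k, E (k + 1) + κ * e k ≤ E k := by
    intro k
    have hrow : ∀ i, ∫ ω, x (k + 1) i ω ^ 2 ∂μ +
        1 / 2 * ∫ ω, (x k a ω - x k b ω) ^ 2 * (U k ω i a * U k ω i b) ∂μ ≤
        ∑ j, ∫ ω, x k j ω ^ 2 * U k ω i j ∂μ := by
      intro i
      rw [← integral_const_mul, ← integral_add (hsqi _ i) ((hprod k i).const_mul _),
        ← integral_finsetSum _ fun j _ => hU.integrable_past_mul (hsqm k j) (hsqb k j) i j]
      refine integral_mono ((hsqi _ i).add ((hprod k i).const_mul _))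
        (integrable_finsetSum _ fun j _ => hU.integrable_past_mul (hsqm k j) (hsqb k j) i j)
        fun ω => ?_
      have h := sq_sum_add_le (hU.nonneg k ω i) (hU.sum_row k ω i) (fun j => x k j ω) a b
      have e₁ : ∑ j, U k ω i j * x k j ω ^ 2 = ∑ j, x k j ω ^ 2 * U k ω i j :=
        Finset.sum_congr rfl fun j _ => mul_comm _ _
      rw [e₁, mul_comm (U k ω i a * U k ω i b)] at h
      exact h
    have hsum := Finset.sum_le_sum fun i (_ : i ∈ Finset.univ) =>
      mul_le_mul_of_nonneg_left (hrow i) (hπ0 i).le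
    simp only [Finset.mul_sum, mul_add, Finset.sum_add_distrib] at hsum
    rw [hπ.sum_integral hU (hsqm k)] at hsum
    have hlow : κ * e k ≤ ∑ i, π i *
        (1 / 2 * ∫ ω, (x k a ω - x k b ω) ^ 2 * (U k ω i a * U k ω i b) ∂μ) := by
      calc κ * e k = 1 / 2 * π i₀ * (γ * e k) := by rw [hκ]; ring
        _ ≤ 1 / 2 * π i₀ * ∑ i, ∫ ω, (x k a ω - x k b ω) ^ 2 * (U k ω i a * U k ω i b) ∂μ :=
          mul_le_mul_of_nonneg_left (hfeed k) (by have := hπ0 i₀; positivity)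
        _ ≤ _ := by
          rw [Finset.mul_sum]
          refine Finset.sum_le_sum fun i _ => ?_
          have hnn : 0 ≤ ∫ ω, (x k a ω - x k b ω) ^ 2 * (U k ω i a * U k ω i b) ∂μ :=
            integral_nonneg fun ω => mul_nonneg (hD0 k ω)
              (mul_nonneg (hU.nonneg k ω i a) (hU.nonneg k ω i b))
          have := mul_le_mul_of_nonneg_right (hi₀ i) hnn
          linarith
    linarith
  refine summable_of_sum_range_le (c := E 0 / κ) he0 fun n => ?_
  have hpart : ∀ n, E n + κ * ∑ k ∈ Finset.range n, e k ≤ E 0 := by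
    intro n
    induction n with
    | zero => simp
    | succ n ih =>
      rw [Finset.sum_range_succ]
      linarith [hdecr n]
  rw [le_div_iff₀ hκ0]
  linarith [hpart n, hE0 n]

theorem IsIndependentModel.ae_summable_flow_mul_sq (hU : IsIndependentModel μ U)
    {π : Fin m → ℝ} (hπ0 : ∀ i, 0 < π i) (hπ : IsCommonSteadyState μ U π)
    (hfb : WeakFeedback μ U) (l a b : Fin m) :
    ∀ᵐ ω ∂μ, Summable fun k => (transition (fun k => U k ω) k a l -
      transition (fun k => U k ω) k b l) ^ 2 * (U k ω a b + U k ω b a) := by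
  rcases eq_or_ne a b with rfl | hab
  · simp
  have hDm : ∀ k, Measurable[past U k] fun ω => (transition (fun k => U k ω) k a l -
      transition (fun k => U k ω) k b l) ^ 2 := fun k =>
    ((measurable_past_transition U k a l).sub (measurable_past_transition U k b l)).pow_const 2
  have hDb : ∀ k ω, |(transition (fun k => U k ω) k a l -
      transition (fun k => U k ω) k b l) ^ 2| ≤ 4 := fun k ω => by
    have h₁ := abs_le.1 (hU.abs_transition_le_one k ω a l)
    have h₂ := abs_le.1 (hU.abs_transition_le_one k ω b l)
    rw [abs_of_nonneg (sq_nonneg _)]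
    nlinarith [h₁.1, h₁.2, h₂.1, h₂.2]
  refine ae_summable_of_summable_integral
    (fun k ω => mul_nonneg (sq_nonneg _) (add_nonneg (hU.nonneg k ω a b) (hU.nonneg k ω b a)))
    (fun k => ((hDm k).mono (hU.past_le k) le_rfl).mul
      ((hU.measurable k a b).add (hU.measurable k b a)))
    (fun k => ?_) (hU.summable_integral_flow_mul_sq hπ0 hπ hfb l hab)
  simp only [mul_add]
  exact (hU.integrable_past_mul (hDm k) (hDb k) a b).add
    (hU.integrable_past_mul (hDm k) (hDb k) b a)

/-- Each column of the transition matrices converges almost surely. -/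
theorem IsIndependentModel.ae_exists_tendsto_transition (hU : IsIndependentModel μ U)
    {π : Fin m → ℝ} (hπ0 : ∀ i, 0 < π i) (hπ : IsCommonSteadyState μ U π)
    (hfb : WeakFeedback μ U) (l : Fin m) :
    ∀ᵐ ω ∂μ, ∀ i, ∃ L, Tendsto (fun k => transition (fun k => U k ω) k i l) atTop (𝓝 L) := by
  have hsq : ∀ᵐ ω ∂μ, ∀ a b, Summable fun k => (transition (fun k => U k ω) k a l -
      transition (fun k => U k ω) k b l) ^ 2 * (U k ω a b + U k ω b a) :=
    ae_all_iff.2 fun a => ae_all_iff.2 fun b => hU.ae_summable_flow_mul_sq hπ0 hπ hfb l a b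
  have habs : ∀ᵐ ω ∂μ, ∀ q : ℚ, ∃ L, Tendsto
      (fun k => ∑ j, π j * |transition (fun k => U k ω) k j l - q|) atTop (𝓝 L) :=
    ae_all_iff.2 fun q => hU.ae_exists_tendsto_weighted_abs hπ0 hπ l q
  filter_upwards [hsq, habs] with ω hsqω habsω
  refine exists_tendsto_of_tendsto_weighted_abs hπ0
    (x := fun k i => transition (fun k => U k ω) k i l)
    (fun k i => hU.abs_transition_le_one k ω i l) (fun i => ?_) habsω
  have hzero : Tendsto (fun k => ∑ j, (transition (fun k => U k ω) k i l -
      transition (fun k => U k ω) k j l) ^ 2 * (U k ω i j + U k ω j i)) atTop (𝓝 0) := by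
    simpa using tendsto_finsetSum Finset.univ fun j _ => (hsqω i j).tendsto_atTop_zero
  -- By Jensen the squared increment is at most Σ_j U_ij (x_j - x_i)², which is dominated by terms
  -- of convergent series.
  have hsqlim : Tendsto (fun k => (transition (fun k => U k ω) (k + 1) i l -
      transition (fun k => U k ω) k i l) ^ 2) atTop (𝓝 0) := by
    refine squeeze_zero (fun k => sq_nonneg _) (fun k => ?_) hzero
    have e : transition (fun k => U k ω) (k + 1) i l - transition (fun k => U k ω) k i l =
        ∑ j, U k ω i j * (transition (fun k => U k ω) k j l -
          transition (fun k => U k ω) k i l) := by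
      simp only [mul_sub, Finset.sum_sub_distrib, ← Finset.sum_mul, hU.sum_row, one_mul]
      rfl
    rw [e]
    refine (sq_sum_le (hU.nonneg k ω i) (hU.sum_row k ω i) _).trans
      (Finset.sum_le_sum fun j _ => ?_)
    rw [sub_sq_comm, mul_comm]
    exact mul_le_mul_of_nonneg_left (le_add_of_nonneg_right (hU.nonneg k ω j i)) (sq_nonneg _)
  have := hsqlim.sqrt
  simp only [Real.sqrt_sq_eq_abs, Real.sqrt_zero] at this
  exact (tendsto_zero_iff_abs_tendsto_zero _).2 this

theorem IsIndependentModel.ae_stable (hU : IsIndependentModel μ U)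
    {π : Fin m → ℝ} (hπ0 : ∀ i, 0 < π i) (hπ : IsCommonSteadyState μ U π)
    (hfb : WeakFeedback μ U) : ∀ᵐ ω ∂μ, Stable fun k => U k ω := by
  obtain ⟨γ, hγ, hfb⟩ := hfb
  have h : ∀ᵐ ω ∂μ, ∀ t l i, ∃ L,
      Tendsto (fun k => transition (fun k => U (t + k) ω) k i l) atTop (𝓝 L) :=
    ae_all_iff.2 fun t => ae_all_iff.2 fun l =>
      (hU.shift t).ae_exists_tendsto_transition hπ0 (fun k => hπ (t + k))
        ⟨γ, hγ, fun k => hfb (t + k)⟩ l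
  filter_upwards [h] with ω hω i
  exact ergodicIndex_iff_transition.2 fun t l => hω t l i

/-- Indices with infinite flow between them are mutually weakly ergodic. -/
theorem IsIndependentModel.ae_mutuallyWeaklyErgodic (hU : IsIndependentModel μ U)
    {π : Fin m → ℝ} (hπ0 : ∀ i, 0 < π i) (hπ : IsCommonSteadyState μ U π)
    (hfb : WeakFeedback μ U) {i j : Fin m}
    (hflow : ∀ᵐ ω ∂μ, InfiniteFlow (fun k => U k ω) i j) :
    ∀ᵐ ω ∂μ, MutuallyWeaklyErgodic (fun k => U k ω) i j := by
  have hstable := hU.ae_stable hπ0 hπ hfb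
  obtain ⟨γ, hγ, hfb⟩ := hfb
  have h : ∀ᵐ ω ∂μ, ∀ t l, Summable fun k => (transition (fun k => U (t + k) ω) k i l -
      transition (fun k => U (t + k) ω) k j l) ^ 2 * (U (t + k) ω i j + U (t + k) ω j i) :=
    ae_all_iff.2 fun t => ae_all_iff.2 fun l =>
      (hU.shift t).ae_summable_flow_mul_sq hπ0 (fun k => hπ (t + k))
        ⟨γ, hγ, fun k => hfb (t + k)⟩ l i j
  filter_upwards [h, hstable, hflow] with ω hω hst hfl
  rw [infiniteFlow_iff fun k => hU.stochastic k ω] at hfl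
  refine mutuallyWeaklyErgodic_iff_transition.2 fun t l => ?_
  obtain ⟨Li, hLi⟩ := ergodicIndex_iff_transition.1 (hst i) t l
  obtain ⟨Lj, hLj⟩ := ergodicIndex_iff_transition.1 (hst j) t l
  have hlim := hLi.sub hLj
  suffices hL : Li - Lj = 0 by rwa [hL] at hlim
  -- Were the limits different, (x_i - x_j)² would eventually exceed half its positive limit, and
  -- the summable weighted squares would dominate the flow.
  by_contra hL
  have hpos : 0 < (Li - Lj) ^ 2 := by positivity
  have hev := (hlim.pow 2).eventually (lt_mem_nhds (half_lt_self hpos))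
  refine hfl ((summable_nat_add_iff t).1 ?_)
  simp only [add_comm _ t]
  have hdom := (hω t l).mul_left (2 / (Li - Lj) ^ 2)
  refine Summable.of_norm_bounded_eventually_nat hdom (hev.mono fun k hk => ?_)
  have hnn : 0 ≤ U (t + k) ω i j + U (t + k) ω j i :=
    add_nonneg (hU.nonneg _ ω i j) (hU.nonneg _ ω j i)
  rw [Real.norm_of_nonneg hnn, ← mul_assoc]
  refine le_mul_of_one_le_left hnn ?_
  rw [div_mul_eq_mul_div, le_div_iff₀ hpos]
  linarith

end Stability

end RandomChain

end

/-! ### Transfer from `U` to `W` and the cycle of implications. -/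

theorem mainTheorem1 {m : ℕ} {Ω : Type*} [MeasurableSpace Ω]
    (μ : MeasureTheory.Measure Ω) [MeasureTheory.IsProbabilityMeasure μ]
    (W U : ℕ → Ω → Matrix (Fin m) (Fin m) ℝ)
    (hW : RandomChain.IsIndependentModel μ W)
    (hU : RandomChain.IsIndependentModel μ U)
    (hWU : RandomChain.IsL1Approximation μ W U)
    (π : Fin m → ℝ) (hπ : ∀ i, 0 < π i)
    (hsteady : RandomChain.IsCommonSteadyState μ U π)
    (hfeedback : RandomChain.WeakFeedback μ U) :
    (∀ᵐ ω ∂μ, RandomChain.Stable fun k => W k ω) ∧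
    ∀ i j : Fin m, List.TFAE
      [∀ᵐ ω ∂μ, RandomChain.MutuallyErgodic (fun k => W k ω) i j,
       RandomChain.MutuallyErgodic (RandomChain.expectedChain μ W) i j,
       (RandomChain.flowGraph (RandomChain.expectedChain μ W)).connectedComponentMk i =
         (RandomChain.flowGraph (RandomChain.expectedChain μ W)).connectedComponentMk j,
       (RandomChain.randomFlowGraph μ W).connectedComponentMk i =
         (RandomChain.randomFlowGraph μ W).connectedComponentMk j] := by
  have happrox : ∀ᵐ ω ∂μ, ∀ i j, Summable fun k => |W k ω i j - U k ω i j| := by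
    refine ae_all_iff.2 fun i => ae_all_iff.2 fun j => ?_
    filter_upwards [hWU i j] with ω hω
    simpa only [abs_sub_comm] using hω
  have hstable : ∀ᵐ ω ∂μ, RandomChain.Stable fun k => W k ω := by
    filter_upwards [happrox, hU.ae_stable hπ hsteady hfeedback] with ω hω hst i
    exact (hst i).of_l1 (fun k => hW.stochastic k ω) (fun k => hU.stochastic k ω) hω
  -- Flow passes from `W` to `U`, and ergodicity comes back from `U` to `W`.
  have hweak : ∀ i j, (∀ᵐ ω ∂μ, RandomChain.InfiniteFlow (fun k => W k ω) i j) →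
      ∀ᵐ ω ∂μ, RandomChain.MutuallyWeaklyErgodic (fun k => W k ω) i j := by
    intro i j hflow
    have hflowU : ∀ᵐ ω ∂μ, RandomChain.InfiniteFlow (fun k => U k ω) i j := by
      filter_upwards [happrox, hflow] with ω hω hfl
      exact hfl.of_l1 (fun k => hW.stochastic k ω) (fun k => hU.stochastic k ω) hω
    filter_upwards [happrox, hU.ae_mutuallyWeaklyErgodic hπ hsteady hfeedback hflowU] with ω hω h
    exact h.of_l1 (fun k => hW.stochastic k ω) (fun k => hU.stochastic k ω) hω
  have hreach : ∀ i j, (RandomChain.randomFlowGraph μ W).Reachable i j →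
      ∀ᵐ ω ∂μ, RandomChain.MutuallyWeaklyErgodic (fun k => W k ω) i j := by
    rintro i j ⟨p⟩
    induction p with
    | nil => exact Eventually.of_forall fun ω t x _ => by simp
    | cons hadj _ ih =>
      filter_upwards [hweak _ _ hadj.2, ih] with ω h₁ h₂ t x hx
      simpa using (h₁ t x hx).add (h₂ t x hx)
  refine ⟨hstable, fun i j => ?_⟩
  simp only [SimpleGraph.ConnectedComponent.eq]
  tfae_have 1 → 2 := hW.mutuallyErgodic_expectedChain
  tfae_have 2 → 3 := fun h => h.2.2.reachable hW.expectedChain_mem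
  tfae_have 3 → 4 := by
    -- One inclusion of graphs is enough, since the implications close into a cycle.
    have hle : RandomChain.flowGraph (RandomChain.expectedChain μ W) ≤
        RandomChain.randomFlowGraph μ W := fun a b hab => ⟨hab.1, hW.ae_infiniteFlow hab.2⟩
    exact fun h => h.mono hle
  tfae_have 4 → 1 := by
    intro h
    filter_upwards [hstable, hreach i j h] with ω hst hω
    exact ⟨hst i, hst j, hω⟩
  tfae_finish
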